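/- Identify $L(\mathbb C^N)$, the linear operators on $\mathbb C^N$, with the complex $N\times N$ matrices in the standard basis. For $X\in L(\mathbb C^N)$ put $\|X\|_1=\mathrm{Tr}\sqrt{X^\dagger X}$, and for a linear map $\Theta:L(\mathbb C^N)\to L(\mathbb C^M)$ put $\|\Theta\|_1=\sup_{\|X\|_1\le 1}\|\Theta(X)\|_1$ and $\|\Theta\|_\diamond=\sup_{m\ge1}\|\Theta\otimes \mathrm{id}_{L(\mathbb C^m)}\|_1$. Let $\mathrm{Conv}(\mathcal U(\mathbb C^N))$ be the convex hull of the unitary channels $X\mapsto UXU^\dagger$ ($U$ unitary) on $L(\mathbb C^N)$; its elements are called mixtures of unitary channels. For a linear map $\Theta:L(\mathbb C^N)\to L(\mathbb C^N)$ put $$D(\Theta,\mathrm{Conv}(\mathcal U(\mathbb C^N)))=\inf\{\|\Theta-\Psi\|_\diamond:\Psi\in\mathrm{Conv}(\mathcal U(\mathbb C^N))\}.$$ A Schur channel on $L(\mathbb C^d)$ is a map of the form $X\mapsto S\circ X$ (entrywise product) with $S\in L(\mathbb C^d)$ positive semidefinite and $S_{kk}=1$ for all $k$. The asymptotic quantum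 Birkhoff conjecture asserts that $\lim_{n\to\infty}D(\Phi^{\otimes n},\mathrm{Conv}(\mathcal U((\mathbb C^d)^{\otimes n})))=0$ for every unital quantum channel $\Phi$ on $L(\mathbb C^d)$, that is, for every completely positive, trace-preserving linear map $\Phi$ with $\Phi(I)=I$. **Corollary.** Let $\Phi$ be a Schur channel on $L(\mathbb C^d)$ with $\Phi\notin\mathrm{Conv}(\mathcal U(\mathbb C^d))$. Then for every $n\ge1$ $$D\bigl(\Phi^{\otimes n},\mathrm{Conv}(\mathcal U((\mathbb C^d)^{\otimes n}))\bigr)\ \ge\ \tfrac12\,D\bigl(\Phi,\mathrm{Conv}(\mathcal U(\mathbb C^d))\bigr).$$ Moreover, $\Phi$ violates the asymptotic quantum Birkhoff conjecture: $\Phi$ is a unital quantum channel, and $D(\Phi^{\otimes n},\mathrm{Conv}(\mathcal U((\mathbb C^d)^{\otimes n})))$ does not converge to $0$ as $n\to\infty$. -/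

import Mathlib

open scoped ENNReal Topology ComplexOrder

noncomputable section

/-- Super-operators: linear maps from the operators on `ℂ^a` to the operators on `ℂ^b`, written as
matrices in the standard orthonormal bases. -/
abbrev SuperOp (a b : Type*) : Type _ := Matrix a a ℂ →ₗ[ℂ] Matrix b b ℂ

section
open scoped MatrixOrder Matrix.Norms.L2Operator

/-- The trace norm `‖X‖₁ = Tr |X|`, where `|X| = √(Xᴴ X)`. -/
def traceNorm {a : Type*} [Fintype a] [DecidableEq a] (X : Matrix a a ℂ) : ℝ :=
  (CFC.abs X).trace.re

end

/-- The super-operator `Φ ⊗ id` on the operators on `ℂ^a ⊗ ℂ^c`: `Φ` is applied to each of the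
blocks of `X` indexed by `c`. -/
def ampliation {a b : Type*} (c : Type*) (Φ : SuperOp a b) : SuperOp (a × c) (b × c) where
  toFun X := Matrix.of fun i j => Φ (Matrix.of fun k l => X (k, i.2) (l, j.2)) i.1 j.1
  map_add' X Y := by
    ext i j
    have h : (Matrix.of fun k l => (X + Y) (k, i.2) (l, j.2) : Matrix a a ℂ)
        = (Matrix.of fun k l => X (k, i.2) (l, j.2))
          + Matrix.of fun k l => Y (k, i.2) (l, j.2) := rfl
    simp only [Matrix.of_apply, Matrix.add_apply] at h ⊢
    rw [h, map_add, Matrix.add_apply]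
  map_smul' r X := by
    ext i j
    have h : (Matrix.of fun k l => (r • X) (k, i.2) (l, j.2) : Matrix a a ℂ)
        = r • (Matrix.of fun k l => X (k, i.2) (l, j.2)) := rfl
    simp only [Matrix.of_apply, Matrix.smul_apply, RingHom.id_apply] at h ⊢
    rw [h, map_smul, Matrix.smul_apply]

/-- `(Φ ⊗ id) (A ⊗ B) = Φ A ⊗ B`, which determines `Φ ⊗ id`. -/
theorem ampliation_kronecker {a b c : Type*} (Φ : SuperOp a b) (A : Matrix a a ℂ)
    (B : Matrix c c ℂ) :
    ampliation c Φ (Matrix.kronecker A B) = Matrix.kronecker (Φ A) B := by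
  ext i j
  have h : (Matrix.of fun k l => Matrix.kronecker A B (k, i.2) (l, j.2) : Matrix a a ℂ)
      = B i.2 j.2 • A := by
    ext k l
    simp [Matrix.kroneckerMap_apply, mul_comm]
  change Φ _ i.1 j.1 = _
  rw [h, map_smul]
  simp [Matrix.kroneckerMap_apply, mul_comm]

/-- The tensor power `Φ^{⊗n}` on the operators on `(ℂ^a)^{⊗n} = ℂ^(a^n)`: the matrix unit
`E_{k₁l₁} ⊗ ⋯ ⊗ E_{kₙlₙ}` is sent to `Φ(E_{k₁l₁}) ⊗ ⋯ ⊗ Φ(E_{kₙlₙ})`. -/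
def tensorPower {a b : Type*} [Fintype a] [DecidableEq a] (n : ℕ) (Φ : SuperOp a b) :
    SuperOp (Fin n → a) (Fin n → b) where
  toFun X := Matrix.of fun i j =>
    ∑ k : Fin n → a, ∑ l : Fin n → a,
      X k l * ∏ t, Φ (Matrix.single (k t) (l t) 1) (i t) (j t)
  map_add' X Y := by
    ext i j
    simp [add_mul, Finset.sum_add_distrib]
  map_smul' r X := by
    ext i j
    simp [mul_assoc, Finset.mul_sum]

/-- `Φ^{⊗n} (X₁ ⊗ ⋯ ⊗ Xₙ) = Φ X₁ ⊗ ⋯ ⊗ Φ Xₙ`, which determines `Φ^{⊗n}`. -/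
theorem tensorPower_prod {a b : Type*} [Fintype a] [DecidableEq a] (n : ℕ) (Φ : SuperOp a b)
    (X : Fin n → Matrix a a ℂ) :
    tensorPower n Φ (Matrix.of fun k l => ∏ t, X t (k t) (l t))
      = Matrix.of fun i j => ∏ t, Φ (X t) (i t) (j t) := by
  ext i j
  have h (t : Fin n) : Φ (X t) (i t) (j t)
      = ∑ k, ∑ l, X t k l * Φ (Matrix.single k l 1) (i t) (j t) := by
    conv_lhs => rw [Matrix.matrix_eq_sum_single (X t)]
    simp only [map_sum, Matrix.sum_apply]
    refine Finset.sum_congr rfl fun k _ => Finset.sum_congr rfl fun l _ => ?_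
    have h2 : Matrix.single k l (X t k l) = X t k l • Matrix.single k l (1 : ℂ) := by simp
    rw [h2, map_smul, Matrix.smul_apply, smul_eq_mul]
  change ∑ k : Fin n → a, ∑ l : Fin n → a, (∏ t, X t (k t) (l t)) *
    ∏ t, Φ (Matrix.single (k t) (l t) 1) (i t) (j t) = ∏ t, Φ (X t) (i t) (j t)
  simp only [h, Fintype.prod_sum, Finset.prod_mul_distrib]

/-- The trace norm of a super-operator, `‖Φ‖₁ = sup {‖Φ X‖₁ : ‖X‖₁ ≤ 1}`. This norm, the diamond norm
and the distances below are valued in `[0, ∞]`, so that the suprema and infima carry no default values. -/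
def superTraceNorm {a b : Type*} [Fintype a] [DecidableEq a] [Fintype b] [DecidableEq b]
    (Φ : SuperOp a b) : ℝ≥0∞ :=
  ⨆ (X : Matrix a a ℂ) (_ : traceNorm X ≤ 1), ENNReal.ofReal (traceNorm (Φ X))

/-- The diamond norm `‖Φ‖_⋄ = sup {‖Φ ⊗ id_{L(ℂ^m)}‖₁ : m ≥ 1}`. -/
def diamondNorm {a b : Type*} [Fintype a] [DecidableEq a] [Fintype b] [DecidableEq b]
    (Φ : SuperOp a b) : ℝ≥0∞ :=
  ⨆ (m : ℕ) (_ : 1 ≤ m), superTraceNorm (ampliation (Fin m) Φ)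

/-- The distance `D(Φ, C) = inf {‖Φ - Ψ‖_⋄ : Ψ ∈ C}`. -/
def diamondDist {a b : Type*} [Fintype a] [DecidableEq a] [Fintype b] [DecidableEq b]
    (Φ : SuperOp a b) (C : Set (SuperOp a b)) : ℝ≥0∞ :=
  ⨅ Ψ ∈ C, diamondNorm (Φ - Ψ)

/-- The super-operator `X ↦ U X Uᴴ`. -/
def conjBy {a : Type*} [Fintype a] (U : Matrix a a ℂ) : SuperOp a a where
  toFun X := U * X * U.conjTranspose
  map_add' X Y := by rw [mul_add, add_mul]
  map_smul' r X := by simp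

/-- The set of unitary channels on the operators on `ℂ^a`. -/
def unitaryChannels (a : Type*) [Fintype a] [DecidableEq a] : Set (SuperOp a a) :=
  {Φ | ∃ U ∈ Matrix.unitaryGroup a ℂ, Φ = conjBy U}

/-- The set of mixtures (convex combinations) of unitary channels. -/
def mixedUnitary (a : Type*) [Fintype a] [DecidableEq a] : Set (SuperOp a a) :=
  convexHull ℝ (unitaryChannels a)

/-- Complete positivity: `Φ ⊗ id_{L(ℂ^m)}` preserves positivity for every `m ≥ 1`. -/
def IsCompletelyPositive {a b : Type*} (Φ : SuperOp a b) : Prop :=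
  ∀ m : ℕ, 1 ≤ m → ∀ X : Matrix (a × Fin m) (a × Fin m) ℂ,
    X.PosSemidef → (ampliation (Fin m) Φ X).PosSemidef

/-- Unital quantum channels: completely positive, trace-preserving and unital. -/
structure IsUnitalChannel {a : Type*} [Fintype a] [DecidableEq a] (Φ : SuperOp a a) : Prop where
  completelyPositive : IsCompletelyPositive Φ
  tracePreserving : ∀ X : Matrix a a ℂ, (Φ X).trace = X.trace
  unital : Φ 1 = 1

/-- The asymptotic quantum Birkhoff property: `D(Φ^{⊗n}, Conv(U((ℂ^a)^{⊗n}))) → 0`. -/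
def AsymptoticBirkhoff {a : Type*} [Fintype a] [DecidableEq a] (Φ : SuperOp a a) : Prop :=
  Filter.Tendsto (fun n : ℕ => diamondDist (tensorPower n Φ) (mixedUnitary (Fin n → a)))
    Filter.atTop (𝓝 0)

/-- The Schur multiplier `X ↦ S ∘ X` (entrywise product). -/
def schurMultiplier {a : Type*} (S : Matrix a a ℂ) : SuperOp a a where
  toFun X := Matrix.hadamard S X
  map_add' X Y := Matrix.hadamard_add S X Y
  map_smul' r X := Matrix.hadamard_smul S X r

/-- The Schur channels: the Schur multipliers of the positive semidefinite matrices with all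
diagonal entries equal to `1`. -/
def schurChannels (a : Type*) : Set (SuperOp a a) :=
  {Φ | ∃ S : Matrix a a ℂ, S.PosSemidef ∧ (∀ k, S k k = 1) ∧ Φ = schurMultiplier S}

end

/-! Because the diagonal entries of `S` are 1, restricting the tensor power to the span of basis
vectors that are constant off one tensor slot gives back `Φ`: with an isometry `J` onto that span,
`Φ` is a `compression` of its own tensor power. It remains to see what compression does to a mixture
of unitary channels `Ψ`.

Each unitary `U` becomes a contraction `V = Jᴴ U J`, which is the midpoint of unitaries `V ± W`;
averaging their channels gives `conjBy V + conjBy W`. So the compression of `Ψ` becomes a mixture of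
unitary channels after adding some `Ω`, a convex combination of maps `conjBy W`
(`exists_compression_add_mem_mixedUnitary`). The diamond norm of such an `Ω` is governed by the
traces of its values (`IsTraceSchwarz.diamondNorm_le`). Since `Φ` and the completed mixture preserve
trace, `Ω` has the same traces as the compressed difference, so its norm is at most the original
error. The triangle inequality gives the factor 2 (`diamondDist_compression_le`).

A zero limit would force the distance of `Φ` itself to vanish, and compactness of the set of
mixtures would then put `Φ` in it. -/

noncomputable section

/-! ### Polar decomposition, trace-norm duality and contractions. -/

section TraceNorm

open Matrix
open scoped MatrixOrder Matrix.Norms.L2Operator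

variable {a b : Type*} [Fintype a] [DecidableEq a] [Fintype b] [DecidableEq b]

/-- Two square matrices with the same Gram matrix differ by a unitary factor on the left. -/
theorem exists_unitary_mul_of_gram_eq {A B : Matrix a a ℂ} (h : Aᴴ * A = Bᴴ * B) :
    ∃ U ∈ Matrix.unitaryGroup a ℂ, A = U * B := by
  set f := toEuclideanCLM (n := a) (𝕜 := ℂ) A with hf
  set g := toEuclideanCLM (n := a) (𝕜 := ℂ) B with hg
  have hstar : star f * f = star g * g := by
    rw [hf, hg, ← map_star, ← map_star, ← map_mul, ← map_mul]
    exact congrArg _ h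
  have hinner (v : EuclideanSpace ℂ a) : ‖f v‖ = ‖g v‖ := by
    have key (k : EuclideanSpace ℂ a →L[ℂ] EuclideanSpace ℂ a) :
        ‖k v‖ ^ 2 = (inner ℂ ((star k * k) v) v).re := by
      rw [ContinuousLinearMap.star_eq_adjoint, mul_apply_eq_comp,
        ContinuousLinearMap.adjoint_inner_left]
      exact (inner_self_eq_norm_sq (𝕜 := ℂ) (k v)).symm
    have h2 : ‖f v‖ ^ 2 = ‖g v‖ ^ 2 := by rw [key f, key g, hstar]
    exact (sq_eq_sq₀ (norm_nonneg _) (norm_nonneg _)).1 h2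
  let f' : EuclideanSpace ℂ a →ₗ[ℂ] EuclideanSpace ℂ a := f
  let g' : EuclideanSpace ℂ a →ₗ[ℂ] EuclideanSpace ℂ a := g
  -- Equal norms make `g v ↦ f v` a well-defined isometry on the range of `g`; finite dimension
  -- extends it to a unitary.
  have hker : LinearMap.ker g' ≤ LinearMap.ker f' := by
    intro v hv
    have hv' : g v = 0 := hv
    have : ‖f v‖ = 0 := by rw [hinner, hv', norm_zero]
    exact norm_eq_zero.1 this
  let L₀ := (LinearMap.ker g').liftQ f' hker ∘ₗ g'.quotKerEquivRange.symm.toLinearMap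
  have hL₀ (v : EuclideanSpace ℂ a) : L₀ ⟨g' v, v, rfl⟩ = f' v := by
    have : g'.quotKerEquivRange.symm ⟨g' v, v, rfl⟩ = (LinearMap.ker g').mkQ v := by
      rw [LinearEquiv.symm_apply_eq]; rfl
    simp only [L₀, LinearMap.comp_apply, LinearEquiv.coe_coe, this]
    rfl
  let L : LinearMap.range g' →ₗᵢ[ℂ] EuclideanSpace ℂ a :=
    { toLinearMap := L₀
      norm_map' := by
        rintro ⟨_, v, rfl⟩
        rw [hL₀]
        exact hinner v }
  have hL (v : EuclideanSpace ℂ a) : L.extend (g v) = f v :=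
    (L.extend_apply ⟨g' v, v, rfl⟩).trans (hL₀ v)
  let W : EuclideanSpace ℂ a →L[ℂ] EuclideanSpace ℂ a := L.extend.toContinuousLinearMap
  have hW : star W * W = 1 := by
    rw [ContinuousLinearMap.star_eq_adjoint]
    exact (ContinuousLinearMap.norm_map_iff_adjoint_comp_self W).1 L.extend.norm_map
  obtain ⟨U, hU⟩ := EquivLike.surjective (toEuclideanCLM (n := a) (𝕜 := ℂ)) W
  refine ⟨U, ?_, ?_⟩
  · rw [Matrix.mem_unitaryGroup_iff']
    apply EquivLike.injective (toEuclideanCLM (n := a) (𝕜 := ℂ))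
    rw [map_mul, map_star, map_one, hU, hW]
  · apply EquivLike.injective (toEuclideanCLM (n := a) (𝕜 := ℂ))
    rw [map_mul, hU]
    ext1 v
    exact (hL v).symm

/-- Polar decomposition. -/
theorem exists_unitary_mul_abs (X : Matrix a a ℂ) :
    ∃ U ∈ Matrix.unitaryGroup a ℂ, X = U * CFC.abs X := by
  apply exists_unitary_mul_of_gram_eq
  have h := CFC.abs_mul_abs X
  have h2 : (CFC.abs X)ᴴ = CFC.abs X := (CFC.abs_nonneg X).isSelfAdjoint
  rw [h2, h]
  rfl

theorem exists_hermitian_mul_self_eq_of_posSemidef {P : Matrix a a ℂ} (hP : P.PosSemidef) :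
    ∃ Q : Matrix a a ℂ, Qᴴ = Q ∧ Q * Q = P :=
  ⟨CFC.sqrt P, (CFC.sqrt_nonneg P).isSelfAdjoint,
    CFC.sqrt_mul_sqrt_self P (nonneg_iff_posSemidef.2 hP)⟩

theorem conjTranspose_mul_self_of_mem_unitaryGroup {U : Matrix a a ℂ}
    (hU : U ∈ Matrix.unitaryGroup a ℂ) : Uᴴ * U = 1 := Matrix.mem_unitaryGroup_iff'.1 hU

/-- The arithmetic-geometric mean inequality for the Hilbert-Schmidt inner product. -/
theorem two_mul_re_trace_mul_conjTranspose_le {m n : Type*} [Fintype m] [Fintype n]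
    (A B : Matrix m n ℂ) :
    2 * (A * Bᴴ).trace.re ≤ (A * Aᴴ).trace.re + (B * Bᴴ).trace.re := by
  have h : 0 ≤ ((A - B) * (A - B)ᴴ).trace := (posSemidef_self_mul_conjTranspose (A - B)).trace_nonneg
  have h1 := (Complex.le_def.1 h).1
  have h2 : (B * Aᴴ).trace.re = (A * Bᴴ).trace.re := by
    have : B * Aᴴ = (A * Bᴴ)ᴴ := by simp
    rw [this, trace_conjTranspose]
    simp
  simp only [conjTranspose_sub, Matrix.mul_sub, Matrix.sub_mul, trace_sub, Complex.sub_re, Complex.zero_re] at h1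
  linarith

/-- With `X = U |X|` and `Q = √|X|`, the trace is the Hilbert-Schmidt pairing of `C U Q` with `Q`,
and both have squared norm `Tr |X|`. -/
theorem re_trace_mul_le_traceNorm {C : Matrix a a ℂ} (hC : C ∈ Matrix.unitaryGroup a ℂ)
    (X : Matrix a a ℂ) : (C * X).trace.re ≤ traceNorm X := by
  obtain ⟨U, hU, hX⟩ := exists_unitary_mul_abs X
  obtain ⟨Q, hQ, hQQ⟩ := exists_hermitian_mul_self_eq_of_posSemidef
    (nonneg_iff_posSemidef.1 (CFC.abs_nonneg X))
  have hD := conjTranspose_mul_self_of_mem_unitaryGroup (mul_mem hC hU)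
  have h := two_mul_re_trace_mul_conjTranspose_le (C * U * Q) Q
  have h1 : (C * U * Q * (C * U * Q)ᴴ).trace = (CFC.abs X).trace := by
    rw [conjTranspose_mul, ← mul_assoc, trace_mul_comm, ← mul_assoc, ← mul_assoc, hD, one_mul, hQ,
      hQQ]
  have h2 : C * X = C * U * Q * Qᴴ := by rw [hQ, mul_assoc _ Q Q, hQQ, mul_assoc C U, ← hX]
  rw [h1, hQ, hQQ] at h
  rw [h2, hQ, traceNorm]
  linarith

theorem exists_traceNorm_eq (X : Matrix a a ℂ) :
    ∃ C ∈ Matrix.unitaryGroup a ℂ, (C * X).trace.re = traceNorm X := by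
  obtain ⟨U, hU, hX⟩ := exists_unitary_mul_abs X
  refine ⟨star U, Unitary.star_mem hU, ?_⟩
  conv_lhs => rw [hX]
  rw [← mul_assoc, Matrix.mem_unitaryGroup_iff'.1 hU, one_mul, traceNorm]

theorem exists_unitary_mul_posSemidef (X : Matrix a a ℂ) :
    ∃ U ∈ Matrix.unitaryGroup a ℂ, ∃ Y : Matrix a a ℂ,
      Y.PosSemidef ∧ X = U * Y ∧ Y.trace.re = traceNorm X := by
  obtain ⟨U, hU, hX⟩ := exists_unitary_mul_abs X
  exact ⟨U, hU, CFC.abs X, nonneg_iff_posSemidef.1 (CFC.abs_nonneg X), hX, rfl⟩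

theorem traceNorm_add_le (X Y : Matrix a a ℂ) :
    traceNorm (X + Y) ≤ traceNorm X + traceNorm Y := by
  obtain ⟨C, hC, h⟩ := exists_traceNorm_eq (X + Y)
  rw [← h, mul_add, trace_add, Complex.add_re]
  exact add_le_add (re_trace_mul_le_traceNorm hC X) (re_trace_mul_le_traceNorm hC Y)

theorem traceNorm_neg (X : Matrix a a ℂ) : traceNorm (-X) = traceNorm X := by
  simp [traceNorm]

theorem traceNorm_of_posSemidef {P : Matrix a a ℂ} (hP : P.PosSemidef) :
    traceNorm P = P.trace.re := by
  rw [traceNorm, CFC.abs_of_nonneg P (nonneg_iff_posSemidef.2 hP)]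

/-- A contraction is the midpoint of two unitaries. -/
theorem exists_add_sub_mem_unitaryGroup {V : Matrix a a ℂ} (hV : ‖V‖ ≤ 1) :
    ∃ W : Matrix a a ℂ, V + W ∈ Matrix.unitaryGroup a ℂ ∧ V - W ∈ Matrix.unitaryGroup a ℂ := by
  obtain ⟨U, hU, hX⟩ := exists_unitary_mul_abs V
  have hP : IsSelfAdjoint (CFC.abs V) := (CFC.abs_nonneg V).isSelfAdjoint
  have hn : ‖CFC.abs V‖ ≤ 1 := by rwa [CFC.norm_abs]
  let _ : CStarAlgebra (Matrix a a ℂ) := {}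
  -- For `P = |V| ≤ 1` the operators `P ± i√(1 - P²)` are unitary with midpoint `P`; multiplying by
  -- the polar factor `U` moves the midpoint to `V`.
  have h := hP.self_add_I_smul_cfcSqrt_sub_sq_mem_unitary _ hn
  have h' := Unitary.star_mem h
  have hs : IsSelfAdjoint (CFC.sqrt (1 - CFC.abs V ^ 2)) := (CFC.sqrt_nonneg _).isSelfAdjoint
  have h3 : star (CFC.abs V + Complex.I • CFC.sqrt (1 - CFC.abs V ^ 2)) =
      CFC.abs V - Complex.I • CFC.sqrt (1 - CFC.abs V ^ 2) := by
    rw [star_add, star_smul, hP.star_eq, hs.star_eq]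
    simp [sub_eq_add_neg]
  rw [h3] at h'
  refine ⟨U * (Complex.I • CFC.sqrt (1 - CFC.abs V ^ 2)), ?_, ?_⟩
  · have := mul_mem hU h
    rwa [mul_add, ← hX] at this
  · have := mul_mem hU h'
    rwa [mul_sub, ← hX] at this

theorem re_trace_mul_le_traceNorm_of_norm_le_one {C : Matrix a a ℂ} (hC : ‖C‖ ≤ 1)
    (X : Matrix a a ℂ) : (C * X).trace.re ≤ traceNorm X := by
  obtain ⟨W, h1, h2⟩ := exists_add_sub_mem_unitaryGroup hC
  have h1 := re_trace_mul_le_traceNorm h1 X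
  have h2 := re_trace_mul_le_traceNorm h2 X
  simp only [add_mul, sub_mul, trace_add, trace_sub, Complex.add_re, Complex.sub_re] at h1 h2
  linarith

theorem l2_opNorm_le_one_of_conjTranspose_mul_self {m : Type*} [Fintype m] {J : Matrix m a ℂ}
    (hJ : Jᴴ * J = 1) :
    ‖J‖ ≤ 1 := by
  have h := l2_opNorm_conjTranspose_mul_self J
  -- Only an inequality, since the index type may be empty.
  have h1 : ‖(1 : Matrix a a ℂ)‖ ≤ 1 := by
    rw [← diagonal_one, l2_opNorm_diagonal]
    exact (pi_norm_le_iff_of_nonneg zero_le_one).2 fun _ => by simp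
  rw [hJ] at h
  nlinarith [norm_nonneg J]

/-- The trace norm does not increase under compression. -/
theorem traceNorm_mul_mul_le {A : Matrix b a ℂ} {B : Matrix a b ℂ} (hA : ‖A‖ ≤ 1) (hB : ‖B‖ ≤ 1)
    (X : Matrix a a ℂ) : traceNorm (A * X * B) ≤ traceNorm X := by
  obtain ⟨C, hC, h⟩ := exists_traceNorm_eq (A * X * B)
  rw [← h, ← Matrix.mul_assoc, trace_mul_comm, ← Matrix.mul_assoc, ← Matrix.mul_assoc]
  refine re_trace_mul_le_traceNorm_of_norm_le_one ?_ X
  have hC1 : ‖C‖ ≤ 1 := l2_opNorm_le_one_of_conjTranspose_mul_self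
    (conjTranspose_mul_self_of_mem_unitaryGroup hC)
  have h1 : ‖B * C‖ ≤ 1 :=
    (l2_opNorm_mul B C).trans (mul_le_one₀ hB (norm_nonneg _) hC1)
  exact (l2_opNorm_mul (B * C) A).trans (mul_le_one₀ h1 (norm_nonneg _) hA)

theorem norm_single_le_one (i j : a) {z : ℂ} (hz : ‖z‖ ≤ 1) :
    ‖(Matrix.single i j z : Matrix a a ℂ)‖ ≤ 1 := by
  have h := l2_opNorm_conjTranspose_mul_self (Matrix.single i j z : Matrix a a ℂ)
  have h1 : (Matrix.single i j z : Matrix a a ℂ)ᴴ * Matrix.single i j z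
      = diagonal (Pi.single j (star z * z)) := by
    rw [conjTranspose_single, single_mul_single_same, diagonal_single]
  rw [h1, l2_opNorm_diagonal, Pi.norm_single] at h
  simp only [norm_mul, norm_star] at h
  nlinarith [norm_nonneg (Matrix.single i j z : Matrix a a ℂ), norm_nonneg z]

/-- Duality, tested on a matrix unit carrying the phase conjugate to that of the entry. -/
theorem norm_apply_le_traceNorm (X : Matrix a a ℂ) (i j : a) : ‖X i j‖ ≤ traceNorm X := by
  by_cases h0 : X i j = 0
  · rw [h0, norm_zero, traceNorm]
    exact (Complex.le_def.1 (nonneg_iff_posSemidef.1 (CFC.abs_nonneg X)).trace_nonneg).1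
  have hn : (‖X i j‖ : ℂ) ≠ 0 := by simpa using h0
  have hz : ‖star (X i j) / ‖X i j‖‖ ≤ 1 := by
    rw [norm_div, norm_star, Complex.norm_real, norm_norm, div_self (by simpa using h0)]
  have h := re_trace_mul_le_traceNorm_of_norm_le_one (norm_single_le_one j i hz) X
  have h2 : (Matrix.single j i (star (X i j) / ‖X i j‖) * X).trace = (‖X i j‖ : ℂ) := by
    rw [trace_single_mul, smul_eq_mul, div_mul_eq_mul_div, div_eq_iff hn]
    simpa [sq] using Complex.conj_mul' (X i j)
  rw [h2] at h
  simpa using h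

theorem traceNorm_single_le_one (i j : a) : traceNorm (Matrix.single i j (1 : ℂ)) ≤ 1 := by
  obtain ⟨C, hC, h⟩ := exists_traceNorm_eq (Matrix.single i j (1 : ℂ))
  rw [← h, trace_mul_single, MulOpposite.op_one, one_smul]
  exact (Complex.re_le_norm _).trans (entry_norm_bound_of_unitary hC j i)

end TraceNorm

/-! ### Ampliations, compressions and the diamond norm. -/

section SuperOperators

open Matrix
open scoped Kronecker

variable {a b c : Type*}

section Ampliation

theorem ampliation_add (Φ Ψ : SuperOp a b) :
    ampliation c (Φ + Ψ) = ampliation c Φ + ampliation c Ψ := rfl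

theorem ampliation_sub (Φ Ψ : SuperOp a b) :
    ampliation c (Φ - Ψ) = ampliation c Φ - ampliation c Ψ := rfl

theorem ampliation_real_smul (t : ℝ) (Φ : SuperOp a b) :
    ampliation c (t • Φ) = t • ampliation c Φ := rfl

theorem ampliation_comp {e : Type*} (Φ : SuperOp b e) (Ψ : SuperOp a b) :
    ampliation c (Φ ∘ₗ Ψ) = ampliation c Φ ∘ₗ ampliation c Ψ := rfl

/-- The super-operator `X ↦ A X Aᴴ` for a possibly rectangular matrix `A`. -/
def conjugation [Fintype a] (A : Matrix b a ℂ) : SuperOp a b where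
  toFun X := A * X * Aᴴ
  map_add' X Y := by rw [Matrix.mul_add, Matrix.add_mul]
  map_smul' r X := by simp

theorem conjugation_apply [Fintype a] (A : Matrix b a ℂ) (X : Matrix a a ℂ) :
    conjugation A X = A * X * Aᴴ := rfl

theorem conjBy_eq_conjugation [Fintype a] (U : Matrix a a ℂ) : conjBy U = conjugation U := rfl

theorem ampliation_conjugation [Fintype a] [Fintype c] [DecidableEq c] (A : Matrix b a ℂ) :
    ampliation c (conjugation A) = conjugation (A ⊗ₖ (1 : Matrix c c ℂ)) := by
  ext1 X
  ext ⟨i, p⟩ ⟨j, q⟩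
  change (A * (Matrix.of fun k l => X (k, p) (l, q)) * Aᴴ) i j = _
  simp only [conjugation_apply, mul_apply, conjTranspose_apply, of_apply, kroneckerMap_apply,
    one_apply, Fintype.sum_prod_type, mul_ite, ite_mul, mul_one, mul_zero, zero_mul, star_zero,
    apply_ite star, Finset.sum_ite_eq, Finset.mem_univ, if_true]

theorem trace_ampliation [Fintype b] [Fintype c] (Φ : SuperOp a b) (X : Matrix (a × c) (a × c) ℂ) :
    (ampliation c Φ X).trace = ∑ p, (Φ (Matrix.of fun k l => X (k, p) (l, p))).trace := by
  rw [trace, Fintype.sum_prod_type_right]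
  rfl

theorem conjTranspose_kronecker_one_mul_self [Fintype a] [Fintype b] [DecidableEq a] [Fintype c]
    [DecidableEq c] {J : Matrix b a ℂ} (hJ : Jᴴ * J = 1) :
    (J ⊗ₖ (1 : Matrix c c ℂ))ᴴ * J ⊗ₖ (1 : Matrix c c ℂ) = 1 := by
  rw [conjTranspose_kronecker, ← mul_kronecker_mul, hJ, conjTranspose_one, one_mul,
    one_kronecker_one]

end Ampliation

variable [Fintype a] [Fintype b]

/-- The compression `X ↦ Jᴴ Ψ(J X Jᴴ) J` of a super-operator. -/
def compression (J : Matrix b a ℂ) (Ψ : SuperOp b b) : SuperOp a a :=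
  conjugation Jᴴ ∘ₗ Ψ ∘ₗ conjugation J

theorem compression_apply (J : Matrix b a ℂ) (Ψ : SuperOp b b) (X : Matrix a a ℂ) :
    compression J Ψ X = Jᴴ * Ψ (J * X * Jᴴ) * J := by
  simp [compression, conjugation_apply]

theorem compression_sub (J : Matrix b a ℂ) (Φ Ψ : SuperOp b b) :
    compression J (Φ - Ψ) = compression J Φ - compression J Ψ := by
  rw [compression, LinearMap.sub_comp, LinearMap.comp_sub]; rfl

theorem compression_add (J : Matrix b a ℂ) (Φ Ψ : SuperOp b b) :
    compression J (Φ + Ψ) = compression J Φ + compression J Ψ := by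
  rw [compression, LinearMap.add_comp, LinearMap.comp_add]; rfl

theorem compression_real_smul (J : Matrix b a ℂ) (t : ℝ) (Φ : SuperOp b b) :
    compression J (t • Φ) = t • compression J Φ := by
  ext1 X
  simp [compression_apply]

theorem compression_conjBy (J : Matrix b a ℂ) (U : Matrix b b ℂ) :
    compression J (conjBy U) = conjBy (Jᴴ * U * J) := by
  ext1 X
  simp [compression_apply, conjBy, Matrix.mul_assoc]

variable [DecidableEq b]

/-- The completely bounded trace inequality of Cauchy-Schwarz type that completely positive maps
satisfy. -/
def IsTraceSchwarz (Ω : SuperOp a b) : Prop :=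
  ∀ (m : ℕ) (C : Matrix (b × Fin m) (b × Fin m) ℂ) (U Y : Matrix (a × Fin m) (a × Fin m) ℂ),
    C ∈ Matrix.unitaryGroup _ ℂ → Y.PosSemidef →
    2 * (C * ampliation (Fin m) Ω (U * Y)).trace.re ≤
      (ampliation (Fin m) Ω Y).trace.re + (ampliation (Fin m) Ω (U * Y * Uᴴ)).trace.re

/-- The inequality is linear in the map, so it survives the passage from unitary channels to their
convex hull. -/
theorem IsTraceSchwarz.combination {Ω₁ Ω₂ : SuperOp a b} (h₁ : IsTraceSchwarz Ω₁)
    (h₂ : IsTraceSchwarz Ω₂) {s t : ℝ} (hs : 0 ≤ s) (ht : 0 ≤ t) :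
    IsTraceSchwarz (s • Ω₁ + t • Ω₂) := by
  intro m C U Y hC hY
  have h1 := mul_le_mul_of_nonneg_left (h₁ m C U Y hC hY) hs
  have h2 := mul_le_mul_of_nonneg_left (h₂ m C U Y hC hY) ht
  simp only [ampliation_add, ampliation_real_smul, LinearMap.add_apply, LinearMap.smul_apply,
    mul_add, mul_smul_comm, trace_add, trace_smul, Complex.add_re, Complex.smul_re, smul_eq_mul]
  linarith

variable [DecidableEq a]

section Norms

theorem superTraceNorm_le_iff {Φ : SuperOp a b} {r : ℝ≥0∞} : superTraceNorm Φ ≤ r ↔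
    ∀ X, traceNorm X ≤ 1 → ENNReal.ofReal (traceNorm (Φ X)) ≤ r := by
  simp only [superTraceNorm, iSup_le_iff]

theorem ofReal_traceNorm_le_superTraceNorm (Φ : SuperOp a b) {X : Matrix a a ℂ}
    (hX : traceNorm X ≤ 1) : ENNReal.ofReal (traceNorm (Φ X)) ≤ superTraceNorm Φ :=
  superTraceNorm_le_iff.1 le_rfl X hX

theorem superTraceNorm_sub_le (Φ Ψ : SuperOp a b) :
    superTraceNorm (Φ - Ψ) ≤ superTraceNorm Φ + superTraceNorm Ψ := by
  refine superTraceNorm_le_iff.2 fun X hX => ?_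
  have h : traceNorm (Φ X - Ψ X) ≤ traceNorm (Φ X) + traceNorm (Ψ X) := by
    rw [sub_eq_add_neg, ← traceNorm_neg (Ψ X)]
    exact traceNorm_add_le _ _
  exact (ENNReal.ofReal_le_ofReal h).trans (ENNReal.ofReal_add_le.trans
    (add_le_add (ofReal_traceNorm_le_superTraceNorm Φ hX)
      (ofReal_traceNorm_le_superTraceNorm Ψ hX)))

theorem diamondNorm_le_iff {Φ : SuperOp a b} {r : ℝ≥0∞} : diamondNorm Φ ≤ r ↔
    ∀ m : ℕ, 1 ≤ m → superTraceNorm (ampliation (Fin m) Φ) ≤ r := by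
  simp only [diamondNorm, iSup_le_iff]

theorem superTraceNorm_ampliation_le_diamondNorm (Φ : SuperOp a b) {m : ℕ} (hm : 1 ≤ m) :
    superTraceNorm (ampliation (Fin m) Φ) ≤ diamondNorm Φ :=
  diamondNorm_le_iff.1 le_rfl m hm

theorem diamondNorm_sub_le (Φ Ψ : SuperOp a b) :
    diamondNorm (Φ - Ψ) ≤ diamondNorm Φ + diamondNorm Ψ := by
  refine diamondNorm_le_iff.2 fun m hm => ?_
  rw [ampliation_sub]
  exact (superTraceNorm_sub_le _ _).trans (add_le_add
    (superTraceNorm_ampliation_le_diamondNorm Φ hm)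
    (superTraceNorm_ampliation_le_diamondNorm Ψ hm))

/-- The diamond norm bounds the coefficients of a super-operator. -/
theorem ofReal_norm_apply_single_le_diamondNorm (Φ : SuperOp a b) (k l : a) (i j : b) :
    ENNReal.ofReal ‖Φ (Matrix.single k l 1) i j‖ ≤ diamondNorm Φ := by
  refine le_trans ?_ (superTraceNorm_ampliation_le_diamondNorm Φ le_rfl)
  refine le_trans ?_ (ofReal_traceNorm_le_superTraceNorm _
    (traceNorm_single_le_one (k, (0 : Fin 1)) (l, 0)))
  refine ENNReal.ofReal_le_ofReal (le_trans (le_of_eq ?_)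
    (norm_apply_le_traceNorm _ (i, (0 : Fin 1)) (j, 0)))
  have h : (Matrix.of fun k' l' : a => Matrix.single (k, (0 : Fin 1)) (l, (0 : Fin 1)) (1 : ℂ)
      (k', 0) (l', 0))
      = Matrix.single k l 1 := by
    ext k' l'
    simp [Matrix.single_apply]
  rw [← h]
  rfl

end Norms

section Compression

-- Ampliating a compression by `J` gives the compression by `J ⊗ 1`, again an isometry, and
-- contractions on either side do not increase the trace norm.
open scoped Matrix.Norms.L2Operator in
theorem diamondNorm_compression_le {J : Matrix b a ℂ} (hJ : Jᴴ * J = 1) (Ψ : SuperOp b b) :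
    diamondNorm (compression J Ψ) ≤ diamondNorm Ψ := by
  refine diamondNorm_le_iff.2 fun m hm => ?_
  refine le_trans ?_ (superTraceNorm_ampliation_le_diamondNorm Ψ hm)
  refine superTraceNorm_le_iff.2 fun X hX => ?_
  set K := J ⊗ₖ (1 : Matrix (Fin m) (Fin m) ℂ) with hK
  have hn : ‖K‖ ≤ 1 :=
    l2_opNorm_le_one_of_conjTranspose_mul_self (conjTranspose_kronecker_one_mul_self hJ)
  have hn' : ‖Kᴴ‖ ≤ 1 := by rwa [l2_opNorm_conjTranspose]
  have h : ampliation (Fin m) (compression J Ψ) X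
      = Kᴴ * ampliation (Fin m) Ψ (K * X * Kᴴ) * K := by
    have hK' : Kᴴ = Jᴴ ⊗ₖ (1 : Matrix (Fin m) (Fin m) ℂ) := by
      rw [hK, conjTranspose_kronecker, conjTranspose_one]
    rw [compression, ampliation_comp, ampliation_comp, ampliation_conjugation,
      ampliation_conjugation, ← hK, ← hK']
    simp [conjugation_apply]
  rw [h]
  refine (ENNReal.ofReal_le_ofReal (traceNorm_mul_mul_le hn' hn _)).trans ?_
  exact ofReal_traceNorm_le_superTraceNorm _ ((traceNorm_mul_mul_le hn hn' X).trans hX)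

end Compression

/-! ### Controlling the diamond norm by traces. -/

section TraceSchwarz

/-- With `Q = √Y` and `K = W ⊗ 1`, this is the arithmetic-geometric mean inequality for `C K U Q`
and `K Q`. -/
theorem isTraceSchwarz_conjBy (W : Matrix a a ℂ) : IsTraceSchwarz (conjBy W) := by
  intro m C U Y hC hY
  obtain ⟨Q, hQ, rfl⟩ := exists_hermitian_mul_self_eq_of_posSemidef hY
  rw [conjBy_eq_conjugation, ampliation_conjugation]
  set K := W ⊗ₖ (1 : Matrix (Fin m) (Fin m) ℂ)
  have h := two_mul_re_trace_mul_conjTranspose_le (C * K * U * Q) (K * Q)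
  have h1 : (C * K * U * Q * (C * K * U * Q)ᴴ).trace
      = (conjugation K (U * (Q * Q) * Uᴴ)).trace := by
    have : C * K * U * Q * (C * K * U * Q)ᴴ = C * (conjugation K (U * (Q * Q) * Uᴴ) * Cᴴ) := by
      simp only [conjTranspose_mul, conjugation_apply, hQ, mul_assoc]
    rw [this, trace_mul_comm, mul_assoc, conjTranspose_mul_self_of_mem_unitaryGroup hC, mul_one]
  have h2 : K * Q * (K * Q)ᴴ = conjugation K (Q * Q) := by
    simp only [conjTranspose_mul, conjugation_apply, hQ, mul_assoc]
  have h3 : C * K * U * Q * (K * Q)ᴴ = C * conjugation K (U * (Q * Q)) := by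
    simp only [conjTranspose_mul, conjugation_apply, hQ, mul_assoc]
  rw [h1, h2, h3] at h
  linarith

/-- The diamond norm of a map satisfying `IsTraceSchwarz` is controlled by the trace of its values, hence by any
super-operator with the same traces. -/
theorem IsTraceSchwarz.diamondNorm_le {Ω Δ : SuperOp a b} (h : IsTraceSchwarz Ω)
    (htr : ∀ X, (Ω X).trace = (Δ X).trace) : diamondNorm Ω ≤ diamondNorm Δ := by
  refine diamondNorm_le_iff.2 fun m hm => ?_
  refine le_trans ?_ (superTraceNorm_ampliation_le_diamondNorm Δ hm)
  refine superTraceNorm_le_iff.2 fun X hX => ?_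
  obtain ⟨C, hC, hCX⟩ := exists_traceNorm_eq (ampliation (Fin m) Ω X)
  obtain ⟨U, hU, Y, hY, hXU, hYX⟩ := exists_unitary_mul_posSemidef X
  have hUY := hY.mul_mul_conjTranspose_same U
  have hUYtr : (U * Y * Uᴴ).trace = Y.trace := by
    rw [trace_mul_comm, ← mul_assoc, conjTranspose_mul_self_of_mem_unitaryGroup hU, one_mul]
  -- Applies to both `Y` and `U Y Uᴴ`: they are positive of trace at most 1, and there `Ω` may be
  -- replaced by `Δ` under the trace.
  have key (Z : Matrix (a × Fin m) (a × Fin m) ℂ) (hZ : Z.PosSemidef) (hZt : Z.trace = Y.trace) :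
      ENNReal.ofReal (ampliation (Fin m) Ω Z).trace.re
        ≤ superTraceNorm (ampliation (Fin m) Δ) := by
    have h1 : traceNorm Z ≤ 1 := by rwa [traceNorm_of_posSemidef hZ, hZt, hYX]
    refine le_trans (ENNReal.ofReal_le_ofReal ?_) (ofReal_traceNorm_le_superTraceNorm _ h1)
    have h2 : (ampliation (Fin m) Ω Z).trace = (ampliation (Fin m) Δ Z).trace := by
      rw [trace_ampliation, trace_ampliation]
      exact Finset.sum_congr rfl fun p _ => htr _
    rw [h2]
    simpa using re_trace_mul_le_traceNorm (one_mem _) (ampliation (Fin m) Δ Z)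
  have h0 := h m C U Y hC hY
  rw [hXU] at hCX
  rw [hCX] at h0
  rw [hXU]
  have h1 := key Y hY rfl
  have h2 := key _ hUY hUYtr
  -- The trace norm is at most the mean of these two numbers, hence at most the larger.
  rcases le_total (ampliation (Fin m) Ω Y).trace.re (ampliation (Fin m) Ω (U * Y * Uᴴ)).trace.re
    with h3 | h3
  · exact (ENNReal.ofReal_le_ofReal (by linarith)).trans h2
  · exact (ENNReal.ofReal_le_ofReal (by linarith)).trans h1

end TraceSchwarz

/-! ### Compressing mixtures of unitary channels. -/

section MixedUnitary

open scoped Matrix.Norms.L2Operator in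
/-- A compression of a mixture of unitary channels can be completed to a mixture of unitary
channels. -/
theorem exists_compression_add_mem_mixedUnitary {J : Matrix b a ℂ} (hJ : Jᴴ * J = 1)
    {Ψ : SuperOp b b} (hΨ : Ψ ∈ mixedUnitary b) :
    ∃ Ω : SuperOp a a, IsTraceSchwarz Ω ∧ compression J Ψ + Ω ∈ mixedUnitary a := by
  suffices h : mixedUnitary b ⊆
      {Ψ | ∃ Ω : SuperOp a a, IsTraceSchwarz Ω ∧ compression J Ψ + Ω ∈ mixedUnitary a} from h hΨ
  refine convexHull_min ?_ ?_
  · rintro _ ⟨U, hU, rfl⟩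
    have hJn : ‖J‖ ≤ 1 := l2_opNorm_le_one_of_conjTranspose_mul_self hJ
    have hJn' : ‖Jᴴ‖ ≤ 1 := by rwa [l2_opNorm_conjTranspose]
    have hUn : ‖U‖ ≤ 1 := l2_opNorm_le_one_of_conjTranspose_mul_self
      (conjTranspose_mul_self_of_mem_unitaryGroup hU)
    have hV : ‖Jᴴ * U * J‖ ≤ 1 :=
      (l2_opNorm_mul _ _).trans (mul_le_one₀ ((l2_opNorm_mul _ _).trans
        (mul_le_one₀ hJn' (norm_nonneg _) hUn)) (norm_nonneg _) hJn)
    obtain ⟨W, h1, h2⟩ := exists_add_sub_mem_unitaryGroup hV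
    refine ⟨conjBy W, isTraceSchwarz_conjBy W, ?_⟩
    rw [compression_conjBy]
    set V := Jᴴ * U * J
    -- Parallelogram identity: the cross terms in `V` and `W` cancel.
    have hmid : conjBy V + conjBy W
        = (1 / 2 : ℝ) • conjBy (V + W) + (1 / 2 : ℝ) • conjBy (V - W) := by
      ext1 X
      simp only [conjBy, LinearMap.add_apply, LinearMap.smul_apply, LinearMap.coe_mk,
        AddHom.coe_mk, conjTranspose_add, conjTranspose_sub, mul_add, add_mul, mul_sub, sub_mul]
      module
    rw [hmid]
    exact convex_convexHull ℝ (unitaryChannels a) (subset_convexHull ℝ _ ⟨_, h1, rfl⟩)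
      (subset_convexHull ℝ _ ⟨_, h2, rfl⟩) (by norm_num) (by norm_num) (by norm_num)
  · rintro Ψ₁ ⟨Ω₁, h₁, hm₁⟩ Ψ₂ ⟨Ω₂, h₂, hm₂⟩ s t hs ht hst
    refine ⟨s • Ω₁ + t • Ω₂, h₁.combination h₂ hs ht, ?_⟩
    have hmem := convex_convexHull ℝ (unitaryChannels a) hm₁ hm₂ hs ht hst
    have heq : compression J (s • Ψ₁ + t • Ψ₂) + (s • Ω₁ + t • Ω₂)
        = s • (compression J Ψ₁ + Ω₁) + t • (compression J Ψ₂ + Ω₂) := by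
      rw [compression_add, compression_real_smul, compression_real_smul]
      module
    rw [heq]
    exact hmem

theorem trace_apply_of_mem_mixedUnitary {Ψ : SuperOp a a} (hΨ : Ψ ∈ mixedUnitary a)
    (X : Matrix a a ℂ) : (Ψ X).trace = X.trace := by
  suffices h : mixedUnitary a ⊆ {Ψ | (Ψ X).trace = X.trace} from h hΨ
  refine convexHull_min ?_ ?_
  · rintro _ ⟨U, hU, rfl⟩
    change (U * X * Uᴴ).trace = _
    rw [trace_mul_comm, ← mul_assoc, conjTranspose_mul_self_of_mem_unitaryGroup hU, one_mul]
  · intro Ψ₁ (h₁ : (Ψ₁ X).trace = _) Ψ₂ (h₂ : (Ψ₂ X).trace = _) s t _ _ hst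
    change (s • Ψ₁ X + t • Ψ₂ X).trace = _
    rw [trace_add, trace_smul, trace_smul, h₁, h₂, ← add_smul,
      hst, one_smul]

/-- Compressing to a trace-preserving map at most doubles the distance to the mixtures of unitary
channels. -/
theorem diamondDist_compression_le {J : Matrix b a ℂ} (hJ : Jᴴ * J = 1) (T : SuperOp b b)
    (hT : ∀ X, (compression J T X).trace = X.trace) :
    diamondDist (compression J T) (mixedUnitary a) ≤ 2 * diamondDist T (mixedUnitary b) := by
  rw [diamondDist, diamondDist, ENNReal.mul_iInf_of_ne (by simp) (by simp)]
  refine le_iInf fun Ψ => ?_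
  rw [ENNReal.mul_iInf_of_ne (by simp) (by simp)]
  refine le_iInf fun hΨ => ?_
  obtain ⟨Ω, hΩ, hmem⟩ := exists_compression_add_mem_mixedUnitary hJ hΨ
  refine (iInf₂_le _ hmem).trans ?_
  have hle := diamondNorm_compression_le hJ (T - Ψ)
  rw [compression_sub] at hle
  -- Both `compression J T` and `compression J Ψ + Ω` preserve trace, so `Ω` has the same traces as
  -- this difference.
  have hΩle : diamondNorm Ω ≤ diamondNorm (compression J T - compression J Ψ) := by
    refine hΩ.diamondNorm_le fun X => ?_
    have := trace_apply_of_mem_mixedUnitary hmem X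
    rw [LinearMap.add_apply, trace_add] at this
    rw [LinearMap.sub_apply, trace_sub, hT, ← this]
    ring
  rw [← sub_sub, two_mul]
  exact (diamondNorm_sub_le _ _).trans (add_le_add hle (hΩle.trans hle))

end MixedUnitary

end SuperOperators

/-! ### Compactness of the set of mixtures. -/

section Closedness

/-- In finite dimension the convex hull of a compact set is compact. -/
theorem IsCompact.isCompact_convexHull_of_finiteDimensional {E : Type*} [AddCommGroup E]
    [Module ℝ E] [FiniteDimensional ℝ E] [TopologicalSpace E] [ContinuousAdd E]
    [ContinuousSMul ℝ E] {s : Set E} (hs : IsCompact s) : IsCompact (convexHull ℝ s) := by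
  classical
  rcases s.eq_empty_or_nonempty with rfl | ⟨x₀, hx₀⟩
  · simp
  -- Carathéodory: `N` points suffice, so the hull is a continuous image of the simplex times `s^N`.
  -- Shorter combinations are padded with weight 0 at `x₀`.
  let N := Module.finrank ℝ E + 1
  have hK : IsCompact (stdSimplex ℝ (Fin N) ×ˢ Set.univ.pi fun _ : Fin N => s) :=
    (isCompact_stdSimplex ℝ (Fin N)).prod (isCompact_univ_pi fun _ => hs)
  have hcont : Continuous fun p : (Fin N → ℝ) × (Fin N → E) => ∑ i, p.1 i • p.2 i := by
    fun_prop
  convert hK.image hcont using 1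
  refine Set.Subset.antisymm (fun x hx => ?_) ?_
  · obtain ⟨ι, _, z, w, hz, haff, hw, hw1, rfl⟩ := eq_pos_convex_span_of_mem_convexHull hx
    have hcard : Fintype.card ι ≤ Fintype.card (Fin N) := by
      rw [Fintype.card_fin]
      exact haff.card_le_finrank_succ.trans (Nat.add_le_add_right (Submodule.finrank_le _) 1)
    obtain ⟨f⟩ := Function.Embedding.nonempty_of_card_le hcard
    have hw0 : ∀ i ∉ Set.range f, Function.extend f w 0 i = 0 := fun i hi =>
      Function.extend_apply' _ _ _ hi
    refine ⟨(Function.extend f w 0, Function.extend f z fun _ => x₀), ⟨⟨fun i => ?_, ?_⟩, ?_⟩, ?_⟩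
    · by_cases hi : i ∈ Set.range f
      · obtain ⟨j, rfl⟩ := hi
        simpa only [f.injective.extend_apply] using (hw j).le
      · exact (hw0 i hi).ge
    · rw [← hw1]
      exact (Fintype.sum_of_injective f f.injective _ _ hw0 fun j =>
        (f.injective.extend_apply w 0 j).symm).symm
    · intro i _
      by_cases hi : i ∈ Set.range f
      · obtain ⟨j, rfl⟩ := hi
        simpa only [f.injective.extend_apply] using hz ⟨j, rfl⟩
      · simpa only [Function.extend_apply' _ _ _ hi] using hx₀
    · refine (Fintype.sum_of_injective f f.injective _ _ (fun i hi => ?_) fun j => ?_).symm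
      · simp only [hw0 i hi, zero_smul]
      · simp only [f.injective.extend_apply]
  · rintro _ ⟨⟨w, z⟩, ⟨⟨hw, hw1⟩, hz⟩, rfl⟩
    exact (convex_convexHull ℝ s).sum_mem (fun i _ => hw i) hw1
      fun i _ => subset_convexHull ℝ s (hz i trivial)

open scoped Matrix.Norms.L2Operator in
theorem isCompact_unitaryGroup (a : Type*) [Fintype a] [DecidableEq a] :
    IsCompact (Matrix.unitaryGroup a ℂ : Set (Matrix a a ℂ)) := by
  refine Metric.isCompact_of_isClosed_isBounded isClosed_unitary ?_
  refine isBounded_iff_forall_norm_le.2 ⟨1, fun U hU => ?_⟩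
  exact l2_opNorm_le_one_of_conjTranspose_mul_self
    (conjTranspose_mul_self_of_mem_unitaryGroup hU)

/-- The coefficients of a super-operator in the bases of matrix units. -/
def coefficients {a b : Type*} [DecidableEq a] : SuperOp a b →ₗ[ℝ] (a → a → b → b → ℂ) where
  toFun Φ k l i j := Φ (Matrix.single k l 1) i j
  map_add' _ _ := rfl
  map_smul' _ _ := rfl

theorem coefficients_injective {a b : Type*} [Fintype a] [DecidableEq a] :
    Function.Injective (coefficients (a := a) (b := b)) := by
  intro Φ Ψ h
  refine Matrix.ext_linearMap ℂ fun k l => LinearMap.ext_ring ?_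
  ext i j
  exact congrFun (congrFun (congrFun (congrFun h k) l) i) j

/-- The mixtures of unitary channels are closed for the diamond distance. -/
theorem mem_mixedUnitary_of_diamondDist_eq_zero {a : Type*} [Fintype a] [DecidableEq a]
    {Φ : SuperOp a a} (h : diamondDist Φ (mixedUnitary a) = 0) : Φ ∈ mixedUnitary a := by
  have hcomp : IsCompact (coefficients '' mixedUnitary a) := by
    rw [mixedUnitary, LinearMap.image_convexHull]
    refine IsCompact.isCompact_convexHull_of_finiteDimensional ?_
    have hcont : Continuous fun U : Matrix a a ℂ => coefficients (conjBy U) := by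
      refine continuous_pi fun k => continuous_pi fun l => continuous_pi fun i =>
        continuous_pi fun j => ?_
      have : Continuous fun U : Matrix a a ℂ =>
          U * (Matrix.single k l 1 : Matrix a a ℂ) * U.conjTranspose := by
        fun_prop
      exact this.matrix_elem i j
    convert (isCompact_unitaryGroup a).image hcont using 1
    ext x
    constructor
    · rintro ⟨_, ⟨U, hU, rfl⟩, rfl⟩
      exact ⟨U, hU, rfl⟩
    · rintro ⟨U, hU, rfl⟩
      exact ⟨_, ⟨U, hU, rfl⟩, rfl⟩
  have hmem : coefficients Φ ∈ closure (coefficients '' mixedUnitary a) := by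
    refine Metric.mem_closure_iff.2 fun ε hε => ?_
    have hlt : diamondDist Φ (mixedUnitary a) < ENNReal.ofReal ε := by
      rw [h]; exact ENNReal.ofReal_pos.2 hε
    simp only [diamondDist, iInf_lt_iff] at hlt
    obtain ⟨Ψ, hΨ, hlt⟩ := hlt
    refine ⟨_, ⟨Ψ, hΨ, rfl⟩, ?_⟩
    -- In the sup metric, coefficientwise bounds suffice.
    simp only [dist_pi_lt_iff hε]
    intro k l i j
    rw [dist_eq_norm]
    exact (ENNReal.ofReal_lt_ofReal_iff hε).1
      ((ofReal_norm_apply_single_le_diamondNorm (Φ - Ψ) k l i j).trans_lt hlt)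
  rw [hcomp.isClosed.closure_eq] at hmem
  obtain ⟨Ψ, hΨ, hΨΦ⟩ := hmem
  exact coefficients_injective hΨΦ ▸ hΨ

end Closedness

/-! ### Schur multipliers, their tensor powers and restrictions. -/

section SchurChannels

open Matrix

theorem ampliation_schurMultiplier {a : Type*} (c : Type*) (S : Matrix a a ℂ) :
    ampliation c (schurMultiplier S) = schurMultiplier (S.submatrix Prod.fst Prod.fst) := rfl

theorem isUnitalChannel_schurMultiplier {a : Type*} [Fintype a] [DecidableEq a] {S : Matrix a a ℂ}
    (hS : S.PosSemidef) (hS1 : ∀ k, S k k = 1) : IsUnitalChannel (schurMultiplier S) where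
  completelyPositive m _ X hX := by
    rw [ampliation_schurMultiplier]
    -- Schur product theorem.
    exact (hS.submatrix Prod.fst).hadamard hX
  tracePreserving X := by
    refine Finset.sum_congr rfl fun k _ => ?_
    change S k k * X k k = X k k
    rw [hS1, one_mul]
  unital := by
    ext i j
    change S i j * (1 : Matrix a a ℂ) i j = (1 : Matrix a a ℂ) i j
    rcases eq_or_ne i j with rfl | h
    · rw [hS1, one_mul]
    · rw [one_apply_ne h, mul_zero]

theorem tensorPower_schurMultiplier {a : Type*} [Fintype a] [DecidableEq a] (n : ℕ)
    (S : Matrix a a ℂ) : tensorPower n (schurMultiplier S)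
      = schurMultiplier (Matrix.of fun i j : Fin n → a => ∏ t, S (i t) (j t)) := by
  ext1 X
  ext i j
  change ∑ k : Fin n → a, ∑ l : Fin n → a,
    X k l * ∏ t, (S (i t) (j t) * Matrix.single (k t) (l t) (1 : ℂ) (i t) (j t))
      = (∏ t, S (i t) (j t)) * X i j
  rw [Finset.sum_eq_single i, Finset.sum_eq_single j]
  · simp [mul_comm]
  · intro l _ hl
    obtain ⟨t, ht⟩ := Function.ne_iff.1 hl
    rw [Finset.prod_eq_zero (Finset.mem_univ t), mul_zero]
    simp [ht]
  · simp
  · intro k _ hk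
    obtain ⟨t, ht⟩ := Function.ne_iff.1 hk
    refine Finset.sum_eq_zero fun l _ => ?_
    rw [Finset.prod_eq_zero (Finset.mem_univ t), mul_zero]
    simp [ht]
  · simp

/-- Compressing to a set of basis vectors restricts a Schur multiplier. -/
theorem compression_schurMultiplier {a b : Type*} [Fintype a] [DecidableEq a] [Fintype b]
    [DecidableEq b] {e : a → b} (he : Function.Injective e) (S : Matrix b b ℂ) :
    compression ((1 : Matrix b b ℂ).submatrix id e) (schurMultiplier S)
      = schurMultiplier (S.submatrix e e) := by
  have h (Y : Matrix b b ℂ) :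
      ((1 : Matrix b b ℂ).submatrix id e)ᴴ * Y * (1 : Matrix b b ℂ).submatrix id e
        = Y.submatrix e e := by
    rw [conjTranspose_submatrix, conjTranspose_one]
    ext k l
    simp [mul_apply, one_apply]
  ext1 X
  rw [compression_apply, h]
  ext k l
  change S (e k) (e l) * _ = S (e k) (e l) * _
  simp [mul_apply, one_apply, he.eq_iff]

theorem conjTranspose_mul_self_one_submatrix {a b : Type*} [DecidableEq a] [Fintype b]
    [DecidableEq b] {e : a → b} (he : Function.Injective e) :
    ((1 : Matrix b b ℂ).submatrix id e)ᴴ * (1 : Matrix b b ℂ).submatrix id e = 1 := by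
  ext k l
  simp [mul_apply, one_apply, he.eq_iff]

/-- The distance of a Schur channel to the mixtures of unitary channels is at most twice that of its
tensor powers. -/
theorem diamondDist_schurMultiplier_le_two_mul_tensorPower {a : Type*} [Fintype a] [DecidableEq a]
    [Nonempty a] {S : Matrix a a ℂ} (hS : ∀ k, S k k = 1) {n : ℕ} (hn : 1 ≤ n) :
    diamondDist (schurMultiplier S) (mixedUnitary a)
      ≤ 2 * diamondDist (tensorPower n (schurMultiplier S)) (mixedUnitary (Fin n → a)) := by
  obtain ⟨a₀⟩ := ‹Nonempty a›
  let t₀ : Fin n := ⟨0, hn⟩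
  -- Embeds `ℂ^a` in slot `t₀`, every other slot being frozen at `a₀`; the frozen slots contribute
  -- factors `S a₀ a₀ = 1`.
  let e : a → Fin n → a := fun k => Function.update (fun _ => a₀) t₀ k
  have he : Function.Injective e := Function.update_injective (fun _ => a₀) t₀
  have hcomp : compression ((1 : Matrix (Fin n → a) (Fin n → a) ℂ).submatrix id e)
      (tensorPower n (schurMultiplier S)) = schurMultiplier S := by
    rw [tensorPower_schurMultiplier, compression_schurMultiplier he]
    congr 1
    ext k l
    change ∏ t, S (e k t) (e l t) = S k l
    rw [Finset.prod_eq_single t₀]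
    · simp [e]
    · intro t _ ht
      simp [e, ht, hS]
    · simp
  have h := diamondDist_compression_le (conjTranspose_mul_self_one_submatrix he)
    (tensorPower n (schurMultiplier S)) fun X => by
      rw [hcomp]
      refine Finset.sum_congr rfl fun k _ => ?_
      change S k k * X k k = X k k
      rw [hS, one_mul]
  rwa [hcomp] at h

end SchurChannels

end

theorem corollary2 (d : ℕ) (Φ : SuperOp (Fin d) (Fin d)) (hΦ : Φ ∈ schurChannels (Fin d))
    (hmix : Φ ∉ mixedUnitary (Fin d)) :
    (∀ n : ℕ, 1 ≤ n →
      (1 / 2) * diamondDist Φ (mixedUnitary (Fin d))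
        ≤ diamondDist (tensorPower n Φ) (mixedUnitary (Fin n → Fin d))) ∧
    (IsUnitalChannel Φ ∧ ¬ AsymptoticBirkhoff Φ) := by
  obtain ⟨S, hS, hS1, rfl⟩ := hΦ
  -- For `d = 0` every super-operator is the identity channel, contradicting `hmix`.
  have hne : Nonempty (Fin d) := by
    by_contra hd
    rw [not_nonempty_iff] at hd
    refine hmix (subset_convexHull ℝ _ ⟨1, one_mem _, ?_⟩)
    ext X i
    exact hd.elim i
  have hbound (n : ℕ) (hn : 1 ≤ n) :
      (1 / 2) * diamondDist (schurMultiplier S) (mixedUnitary (Fin d))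
        ≤ diamondDist (tensorPower n (schurMultiplier S)) (mixedUnitary (Fin n → Fin d)) := by
    rw [one_div, mul_comm, ← div_eq_mul_inv]
    exact ENNReal.div_le_of_le_mul' (diamondDist_schurMultiplier_le_two_mul_tensorPower hS1 hn)
  refine ⟨hbound, isUnitalChannel_schurMultiplier hS hS1, fun hlim => hmix ?_⟩
  apply mem_mixedUnitary_of_diamondDist_eq_zero
  -- The constant lower bound passes to the limit 0, so the distance of `Φ` is zero.
  have h0 := ge_of_tendsto hlim (Filter.eventually_atTop.2 ⟨1, hbound⟩)
  simpa using h0
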